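/- For a function $f:\{-1,1\}^n\to\{0,1\}$ let $x$ be uniform on $\{-1,1\}^n$, and write $\mathbb{E}[f]=\mathbb{E}_x[f(x)]$, $\hat f(S)=\mathbb{E}_x\big[f(x)\prod_{i\in S}x_i\big]$ for $S\subseteq\{1,\dots,n\}$, $W^k(f)=\sum_{|S|=k}\hat f(S)^2$, $I_i(f)=\Pr_x[f(x)\ne f(x\oplus e_i)]$, where $x\oplus e_i$ is $x$ with its $i$-th coordinate flipped, and $I_{\max}(f)=\max_i I_i(f)$. A halfspace is a function $f(x)=\mathbf{1}\{\sum_i a_ix_i>t\}$ with $a\in\mathbb{R}^n$, $t\in\mathbb{R}$. Logarithms are natural, and $0^2\log(1/0)^k$ is read as $0$. (a) There exist universal constants $c_1,c_2>0$ such that for every integer $k\ge 1$ and every halfspace $f=\mathbf{1}\{\sum_i a_ix_i>t\}$ with $|a_1|=\max_i|a_i|$ (the index $1$ standing for any index of a weight of maximal absolute value), if $\mathbb{E}[f]<2^{-999k}$ and $I_1(f)\le c_1\,\mathbb{E}[f]/k$, then $$W^k(f)\ \ge\ \frac{(c_2\log(2k))^{-k}}{k!}\,\mathbb{E}[f]^2\Big(\log\frac1{\mathbb{E}[f]}\Big)^k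 .$$ (b) For every integer $k\ge 1$ there exist constants $c_1,c_2,c_3,c_4>0$ depending only on $k$ such that for every halfspace $f$ with $\mathbb{E}[f]\le c_1$ and $I_{\max}(f)\le c_4\,\mathbb{E}[f]$, $$c_2\,\mathbb{E}[f]^2\Big(\log\frac1{\mathbb{E}[f]}\Big)^k\ \le\ W^k(f)\ \le\ c_3\,\mathbb{E}[f]^2\Big(\log\frac1{\mathbb{E}[f]}\Big)^k .$$ -/

import Mathlib

open scoped BigOperators

namespace BooleanCube

/-- The discrete cube `{-1,1}^n`; a coordinate is a unit of `ℤ`, that is `1` or `-1`. -/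
abbrev Cube (n : ℕ) : Type := Fin n → ℤˣ

/-- The character `x^S = ∏_{i ∈ S} x_i`. -/
def chi {n : ℕ} (S : Finset (Fin n)) (x : Cube n) : ℝ :=
  ∏ i ∈ S, ((x i : ℤ) : ℝ)

/-- The expectation `E[f]` with respect to the uniform measure on the cube. -/
noncomputable def mean {n : ℕ} (f : Cube n → ℝ) : ℝ :=
  (∑ x, f x) / 2 ^ n

/-- The Fourier coefficient of `f` at `S`, namely `E[f(x) x^S]`. -/
noncomputable def fourierCoefficient {n : ℕ} (f : Cube n → ℝ) (S : Finset (Fin n)) : ℝ :=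
  mean fun x => f x * chi S x

/-- The level-`k` Fourier weight `W^k(f)`, the sum of the squared Fourier coefficients over all
sets of size `k`. -/
noncomputable def weight {n : ℕ} (k : ℕ) (f : Cube n → ℝ) : ℝ :=
  ∑ S ∈ (Finset.univ : Finset (Fin n)).powersetCard k, fourierCoefficient f S ^ 2

/-- The point obtained from `x` by flipping the coordinate `i`. -/
def flipAt {n : ℕ} (i : Fin n) (x : Cube n) : Cube n :=
  Function.update x i (-x i)

open Classical in
/-- The influence `I_i(f) = Pr[f(x) ≠ f(x ⊕ e_i)]`. -/
noncomputable def influence {n : ℕ} (f : Cube n → ℝ) (i : Fin n) : ℝ :=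
  mean fun x => if f x ≠ f (flipAt i x) then 1 else 0

/-- The maximal influence `I_max(f) = max_i I_i(f)`. -/
noncomputable def maxInfluence {n : ℕ} (f : Cube n → ℝ) : ℝ :=
  ⨆ i, influence f i

open Classical in
/-- The halfspace `1{a · x > t}`. -/
noncomputable def halfspace {n : ℕ} (a : Fin n → ℝ) (t : ℝ) (x : Cube n) : ℝ :=
  if ∑ i, a i * ((x i : ℤ) : ℝ) > t then 1 else 0

end BooleanCube

/-!
Write `E` for the mean of the halfspace `f = 1{a · x > t}`, put `L = log (1 / E)`, and normalise
the weights by `∑ a i ^ 2 = 1`.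

*Lower bound.* The excess `Z = (a · x - t)₊` is supported on `{f = 1}`, so the entropy of `Z ^ 2`
is at least `L` times its mean (`mean_mul_log_le_entropy`). The logarithmic Sobolev inequality
bounds this entropy by the discrete gradient of `Z`, which also lives on the support of `f` and
its neighbours; hence the mean of `Z ^ 2` is at most `8 E / L` (`mean_excess_sq_le`). If the
coordinate `i` of largest weight has influence at most `E`, then half of the mass of `f` lies on
pairs of neighbours in direction `i` which both satisfy `f`, and one of the two has excess greater
than `2 |a i|`. Therefore `(a i) ^ 2 L ≤ 8` (`sq_weight_mul_log_le`). With weights this small, the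
Paley–Zygmund argument for `exp (l a · x)` with `l` of order `√L` shows that the tail at
`√L / 10` exceeds `E`, so `t ≥ √L / 10` (`sqrt_log_le_threshold`). Finally `f` is tested against the
elementary symmetric polynomial `e_k` of the numbers `a i * x i`. Newton's identities make
`e_k ≥ (t / 2) ^ k / k!` wherever `a · x > t`, as `k` is small compared with `t ^ 2` and with
`t / max |a i|` (`pow_div_factorial_le_elemSymm`), while the mean of `e_k ^ 2` is at most `1 / k!`.
By the Cauchy–Schwarz inequality the level-`k` weight is at least
`(t ^ 2 / 4) ^ k / k! * E ^ 2` (`weight_ge_of_threshold`). This gives `(L / 400) ^ k / k! * E ^ 2`,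
and both lower bounds follow from it.

*Upper bound.* This is the level-`k` inequality (`weight_le`), which holds for every
`{0, 1}`-valued function of small mean. It follows from Bonami's inequality for even exponents
(`mean_even_pow_le`), applied to the level-`k` part of `f` with an exponent of order `L`.
-/

namespace BooleanCube

/-! ### Expectations on the cube -/

lemma mean_add {n : ℕ} (f g : Cube n → ℝ) :
    mean (fun x => f x + g x) = mean f + mean g := by
  simp [mean, Finset.sum_add_distrib, add_div]

lemma mean_sub {n : ℕ} (f g : Cube n → ℝ) :
    mean (fun x => f x - g x) = mean f - mean g := by
  simp [mean, Finset.sum_sub_distrib, sub_div]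

lemma mean_const_mul {n : ℕ} (c : ℝ) (f : Cube n → ℝ) :
    mean (fun x => c * f x) = c * mean f := by
  simp [mean, ← Finset.mul_sum, mul_div_assoc]

lemma mean_const {n : ℕ} (c : ℝ) : mean (fun _ : Cube n => c) = c := by
  simp [mean]

lemma mean_sum {n : ℕ} {ι : Type*} (s : Finset ι) (f : ι → Cube n → ℝ) :
    mean (fun x => ∑ i ∈ s, f i x) = ∑ i ∈ s, mean (f i) := by
  simp only [mean, ← Finset.sum_div]
  rw [Finset.sum_comm]

lemma mean_mono {n : ℕ} {f g : Cube n → ℝ} (h : ∀ x, f x ≤ g x) : mean f ≤ mean g := by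
  unfold mean
  gcongr with x
  exact h x

lemma mean_nonneg {n : ℕ} {f : Cube n → ℝ} (h : ∀ x, 0 ≤ f x) : 0 ≤ mean f :=
  div_nonneg (Finset.sum_nonneg fun x _ => h x) (by positivity)

lemma mean_mul_sq_le {n : ℕ} (f g : Cube n → ℝ) :
    mean (fun x => f x * g x) ^ 2 ≤ mean (fun x => f x ^ 2) * mean (fun x => g x ^ 2) := by
  unfold mean
  rw [div_pow, div_mul_div_comm, ← sq]
  gcongr
  exact Finset.sum_mul_sq_le_sq_mul_sq _ _ _

lemma eq_zero_of_mean_eq_zero {n : ℕ} {f : Cube n → ℝ} (h : ∀ x, 0 ≤ f x) (h0 : mean f = 0)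
    (x : Cube n) : f x = 0 := by
  have h1 : ∑ x, f x = 0 := by
    unfold mean at h0
    rcases div_eq_zero_iff.1 h0 with h2 | h2
    · exact h2
    · exact absurd h2 (by positivity)
  exact (Finset.sum_eq_zero_iff_of_nonneg fun x _ => h x).1 h1 x (Finset.mem_univ x)

lemma flipAt_flipAt {n : ℕ} (i : Fin n) (x : Cube n) : flipAt i (flipAt i x) = x := by
  simp [flipAt]

lemma mean_flipAt {n : ℕ} (i : Fin n) (f : Cube n → ℝ) :
    mean (fun x => f (flipAt i x)) = mean f := by
  unfold mean
  congr 1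
  exact Fintype.sum_equiv (Function.Involutive.toPerm _ (flipAt_flipAt i)) _ _ fun x => rfl

lemma coord_sq {n : ℕ} (x : Cube n) (i : Fin n) : (((x i : ℤ) : ℝ)) ^ 2 = 1 := by
  rcases Int.units_eq_one_or (x i) with h | h <;> simp [h]

lemma sum_flipAt {n : ℕ} (a : Fin n → ℝ) (i : Fin n) (x : Cube n) :
    ∑ j, a j * ((flipAt i x j : ℤ) : ℝ) =
      ∑ j, a j * ((x j : ℤ) : ℝ) - 2 * (a i * ((x i : ℤ) : ℝ)) := by
  rw [eq_sub_iff_add_eq, ← Finset.add_sum_erase _ _ (Finset.mem_univ i),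
    ← Finset.add_sum_erase Finset.univ (fun j => a j * ((x j : ℤ) : ℝ)) (Finset.mem_univ i)]
  have h : ∑ j ∈ Finset.univ.erase i, a j * ((flipAt i x j : ℤ) : ℝ) =
      ∑ j ∈ Finset.univ.erase i, a j * ((x j : ℤ) : ℝ) := by
    refine Finset.sum_congr rfl fun j hj => ?_
    rw [flipAt, Function.update_of_ne (Finset.ne_of_mem_erase hj)]
  rw [h]
  simp [flipAt]
  ring

lemma mean_succ {n : ℕ} (f : Cube (n + 1) → ℝ) :
    mean f = (mean (fun y : Cube n => f (Fin.cons 1 y)) +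
      mean (fun y : Cube n => f (Fin.cons (-1) y))) / 2 := by
  have h : ∑ x, f x = ∑ y : Cube n, f (Fin.cons 1 y) + ∑ y : Cube n, f (Fin.cons (-1) y) := by
    rw [← (Fin.consEquiv fun _ : Fin (n + 1) => ℤˣ).sum_comp, Fintype.sum_prod_type]
    simp [Fin.consEquiv]
  unfold mean
  rw [h, pow_succ]
  ring

/-! ### A logarithmic Sobolev inequality -/

/-- The one-coordinate case, with a constant twice the optimal one, which makes
`log u ≤ u - 1` sufficient for the proof. -/
lemma entropy_two_point {p q : ℝ} (hp : 0 ≤ p) (hq : 0 ≤ q) :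
    (p * Real.log p + q * Real.log q) / 2 - (p + q) / 2 * Real.log ((p + q) / 2)
      ≤ (√p - √q) ^ 2 := by
  rcases (add_nonneg hp hq).eq_or_lt with h | h
  · have h1 : p = 0 := by linarith
    have h2 : q = 0 := by linarith
    simp [h1, h2]
  set m := (p + q) / 2 with hm
  have hm0 : 0 < m := by positivity
  have key : ∀ r : ℝ, 0 ≤ r → r * Real.log r ≤ r * Real.log m + r * (r / m - 1) := by
    intro r hr
    rcases hr.eq_or_lt with h0 | h0
    · simp [← h0]
    have h1 := Real.log_le_sub_one_of_pos (div_pos h0 hm0)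
    rw [Real.log_div h0.ne' hm0.ne'] at h1
    nlinarith
  have h1 := key p hp
  have h2 := key q hq
  have h3 : (p * (p / m - 1) + q * (q / m - 1)) / 2 ≤ (√p - √q) ^ 2 := by
    have e : (p * (p / m - 1) + q * (q / m - 1)) / 2 = (p - q) ^ 2 / (4 * m) := by
      field_simp
      rw [hm]
      ring
    rw [e, div_le_iff₀ (by positivity)]
    have e2 : (p - q) ^ 2 = (√p - √q) ^ 2 * (√p + √q) ^ 2 := by
      nth_rewrite 1 [← Real.sq_sqrt hp, ← Real.sq_sqrt hq]
      ring
    have e3 : (√p + √q) ^ 2 ≤ 4 * m := by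
      have := Real.sq_sqrt hp
      have := Real.sq_sqrt hq
      nlinarith [sq_nonneg (√p - √q)]
    rw [e2]
    exact mul_le_mul_of_nonneg_left e3 (sq_nonneg _)
  have h4 : p * Real.log m + q * Real.log m = 2 * m * Real.log m := by rw [hm]; ring
  linarith

/-- Logarithmic Sobolev inequality on the cube (with a non-optimal constant). -/
theorem entropy_sq_le_sum_mean_sq_sub : ∀ {n : ℕ} (g : Cube n → ℝ),
    mean (fun x => g x ^ 2 * Real.log (g x ^ 2)) -
        mean (fun x => g x ^ 2) * Real.log (mean fun x => g x ^ 2)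
      ≤ ∑ i, mean (fun x => (g x - g (flipAt i x)) ^ 2)
  | 0, g => by simp [mean]
  | n + 1, g => by
    have ih1 := entropy_sq_le_sum_mean_sq_sub fun y : Cube n => g (Fin.cons 1 y)
    have ih2 := entropy_sq_le_sum_mean_sq_sub fun y : Cube n => g (Fin.cons (-1) y)
    set p := mean fun y : Cube n => g (Fin.cons 1 y) ^ 2 with hp
    set q := mean fun y : Cube n => g (Fin.cons (-1) y) ^ 2 with hq
    have hp0 : 0 ≤ p := mean_nonneg fun _ => sq_nonneg _
    have hq0 : 0 ≤ q := mean_nonneg fun _ => sq_nonneg _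
    have htwo := entropy_two_point hp0 hq0
    have hsucc : ∀ (i : Fin n) (b : ℤˣ) (y : Cube n),
        flipAt i.succ (Fin.cons b y : Cube (n + 1)) = Fin.cons b (flipAt i y) := by
      intro i b y
      simp [flipAt, Fin.cons_update]
    have hzero : ∀ (b : ℤˣ) (y : Cube n),
        flipAt 0 (Fin.cons b y : Cube (n + 1)) = Fin.cons (-b) y := by
      intro b y
      simp [flipAt]
    rw [Fin.sum_univ_succ]
    simp only [mean_succ (n := n), hsucc, hzero, neg_neg]
    rw [← hp, ← hq, ← Finset.sum_div, Finset.sum_add_distrib]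
    have hsym : mean (fun y : Cube n => (g (Fin.cons (-1) y) - g (Fin.cons 1 y)) ^ 2) =
        mean (fun y : Cube n => (g (Fin.cons 1 y) - g (Fin.cons (-1) y)) ^ 2) := by
      congr 1
      ext y
      ring
    have hdiff : (√p - √q) ^ 2 ≤
        mean (fun y : Cube n => (g (Fin.cons 1 y) - g (Fin.cons (-1) y)) ^ 2) := by
      have e : mean (fun y : Cube n => (g (Fin.cons 1 y) - g (Fin.cons (-1) y)) ^ 2) =
          p + q - 2 * mean (fun y : Cube n => g (Fin.cons 1 y) * g (Fin.cons (-1) y)) := by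
        rw [hp, hq, ← mean_const_mul, ← mean_add, ← mean_sub]
        congr 1
        ext y
        ring
      have hcs : mean (fun y : Cube n => g (Fin.cons 1 y) * g (Fin.cons (-1) y)) ≤ √p * √q := by
        rw [← Real.sqrt_mul hp0]
        exact Real.le_sqrt_of_sq_le (mean_mul_sq_le _ _)
      have := Real.sq_sqrt hp0
      have := Real.sq_sqrt hq0
      rw [e]
      nlinarith
    linarith

/-- A function supported on a set of probability `mean f` has entropy at least
`log (1 / mean f)` times its mean. -/
lemma mean_mul_log_le_entropy {n : ℕ} {f h : Cube n → ℝ} (hf : 0 < mean f)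
    (hh : ∀ x, 0 ≤ h x) (hsupp : ∀ x, f x = 0 ∧ h x = 0 ∨ f x = 1) :
    mean h * Real.log (1 / mean f) ≤
      mean (fun x => h x * Real.log (h x)) - mean h * Real.log (mean h) := by
  rcases (mean_nonneg hh).eq_or_lt with h0 | h0
  · have : ∀ x, h x = 0 := eq_zero_of_mean_eq_zero hh h0.symm
    simp [this, mean]
  -- `c` is the conditional mean of `h`; the tangent line of `y log y` at `c` gives Jensen.
  set c := mean h / mean f with hc
  have hc0 : 0 < c := div_pos h0 hf
  have key : ∀ x, Real.log c * h x + h x - c * f x ≤ h x * Real.log (h x) := by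
    intro x
    rcases hsupp x with ⟨h1, h2⟩ | h1
    · simp [h1, h2]
    rcases (hh x).eq_or_lt with h2 | h2
    · rw [← h2, h1]; simp; exact hc0.le
    have h3 := Real.log_le_sub_one_of_pos (div_pos hc0 h2)
    rw [Real.log_div hc0.ne' h2.ne'] at h3
    have h4 : h x * (c / h x) = c := by field_simp
    rw [h1]
    nlinarith
  have h1 := mean_mono key
  rw [mean_sub, mean_add, mean_const_mul, mean_const_mul] at h1
  have h2 : c * mean f = mean h := by rw [hc]; field_simp
  have h3 : Real.log c = Real.log (mean h) - Real.log (mean f) := Real.log_div h0.ne' hf.ne'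
  rw [one_div, Real.log_inv]
  rw [h2, h3] at h1
  linarith

/-! ### The tail of a halfspace -/

lemma halfspace_eq_zero_or_one {n : ℕ} (a : Fin n → ℝ) (t : ℝ) (x : Cube n) :
    halfspace a t x = 0 ∨ halfspace a t x = 1 := by
  unfold halfspace
  split_ifs <;> simp

lemma halfspace_nonneg {n : ℕ} (a : Fin n → ℝ) (t : ℝ) (x : Cube n) : 0 ≤ halfspace a t x := by
  rcases halfspace_eq_zero_or_one a t x with h | h <;> simp [h]

lemma halfspace_sq {n : ℕ} (a : Fin n → ℝ) (t : ℝ) (x : Cube n) :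
    halfspace a t x ^ 2 = halfspace a t x := by
  rcases halfspace_eq_zero_or_one a t x with h | h <;> simp [h]

lemma lt_of_halfspace_eq_one {n : ℕ} {a : Fin n → ℝ} {t : ℝ} {x : Cube n}
    (h : halfspace a t x = 1) : t < ∑ i, a i * ((x i : ℤ) : ℝ) := by
  by_contra h1
  simp [halfspace, h1] at h

lemma le_of_halfspace_eq_zero {n : ℕ} {a : Fin n → ℝ} {t : ℝ} {x : Cube n}
    (h : halfspace a t x = 0) : ∑ i, a i * ((x i : ℤ) : ℝ) ≤ t := by
  by_contra h1
  rw [not_le] at h1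
  simp [halfspace, h1] at h

/-- The excess `(a · x - t)₊` over the threshold. -/
noncomputable def excess {n : ℕ} (a : Fin n → ℝ) (t : ℝ) (x : Cube n) : ℝ :=
  max (∑ i, a i * ((x i : ℤ) : ℝ) - t) 0

lemma excess_eq_zero {n : ℕ} {a : Fin n → ℝ} {t : ℝ} {x : Cube n} (h : halfspace a t x = 0) :
    excess a t x = 0 :=
  max_eq_right (sub_nonpos.2 (le_of_halfspace_eq_zero h))

lemma sq_excess_sub_flipAt_le {n : ℕ} (a : Fin n → ℝ) (t : ℝ) (i : Fin n) (x : Cube n) :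
    (excess a t x - excess a t (flipAt i x)) ^ 2 ≤
      4 * a i ^ 2 * (halfspace a t x + halfspace a t (flipAt i x)) := by
  have h1 : (excess a t x - excess a t (flipAt i x)) ^ 2 ≤ 4 * a i ^ 2 := by
    have h2 := abs_max_sub_max_le_abs (∑ j, a j * ((x j : ℤ) : ℝ) - t)
      (∑ j, a j * ((flipAt i x j : ℤ) : ℝ) - t) 0
    have h3 := sq_le_sq.2 h2
    rw [sum_flipAt] at h3
    have h4 := coord_sq x i
    unfold excess
    rw [sum_flipAt]
    calc _ ≤ _ := h3
      _ = 4 * a i ^ 2 * ((x i : ℤ) : ℝ) ^ 2 := by ring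
      _ = _ := by rw [h4, mul_one]
  have h0 : 0 ≤ 4 * a i ^ 2 := by positivity
  rcases halfspace_eq_zero_or_one a t x with hx | hx <;>
    rcases halfspace_eq_zero_or_one a t (flipAt i x) with hy | hy
  · simp [excess_eq_zero hx, excess_eq_zero hy, hx, hy]
  all_goals rw [hx, hy]; nlinarith

/-- Local Chernoff bound: conditionally on `a · x > t`, the excess over `t` is typically at most
of order `‖a‖ / √(log (1 / E[f]))`. -/
lemma mean_excess_sq_le {n : ℕ} {a : Fin n → ℝ} {t : ℝ} (ha : ∑ i, a i ^ 2 = 1)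
    (hE : 0 < mean (halfspace a t)) :
    mean (fun x => excess a t x ^ 2) * Real.log (1 / mean (halfspace a t)) ≤
      8 * mean (halfspace a t) := by
  refine (mean_mul_log_le_entropy hE (fun x => sq_nonneg _) fun x => ?_).trans
    ((entropy_sq_le_sum_mean_sq_sub (excess a t)).trans ?_)
  · rcases halfspace_eq_zero_or_one a t x with h | h
    · exact Or.inl ⟨h, by simp [excess_eq_zero h]⟩
    · exact Or.inr h
  calc _ ≤ ∑ i, a i ^ 2 * (8 * mean (halfspace a t)) := by
        refine Finset.sum_le_sum fun i _ => ?_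
        refine (mean_mono (sq_excess_sub_flipAt_le a t i)).trans_eq ?_
        rw [mean_const_mul, mean_add, mean_flipAt]
        ring
    _ = _ := by rw [← Finset.sum_mul, ha, one_mul]

/-- If the influence of a coordinate is at most `E[f]`, then the pairs of neighbours in its
direction that both satisfy `f` carry at least half of the mass of `f`. -/
lemma half_mean_le_mean_mul_flipAt {n : ℕ} {a : Fin n → ℝ} {t : ℝ} {i : Fin n}
    (hI : influence (halfspace a t) i ≤ mean (halfspace a t)) :
    mean (halfspace a t) / 2 ≤
      mean (fun x => halfspace a t x * halfspace a t (flipAt i x)) := by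
  have e : influence (halfspace a t) i = 2 * mean (halfspace a t) -
      2 * mean (fun x => halfspace a t x * halfspace a t (flipAt i x)) := by
    have e1 : 2 * mean (halfspace a t) =
        mean (fun x => halfspace a t x + halfspace a t (flipAt i x)) := by
      rw [mean_add, mean_flipAt, two_mul]
    rw [e1, ← mean_const_mul, ← mean_sub]
    unfold influence
    congr 1
    ext x
    rcases halfspace_eq_zero_or_one a t x with hx | hx <;>
      rcases halfspace_eq_zero_or_one a t (flipAt i x) with hy | hy <;> norm_num [hx, hy]
  linarith

/-- A coordinate of influence at most `E[f]` has a weight of order at most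
`‖a‖ / √(log (1 / E[f]))`. -/
lemma sq_weight_mul_log_le {n : ℕ} {a : Fin n → ℝ} {t : ℝ} (ha : ∑ i, a i ^ 2 = 1)
    (hE : 0 < mean (halfspace a t)) {i : Fin n} (hL : 0 ≤ Real.log (1 / mean (halfspace a t)))
    (hI : influence (halfspace a t) i ≤ mean (halfspace a t)) :
    a i ^ 2 * Real.log (1 / mean (halfspace a t)) ≤ 8 := by
  have h1 := half_mean_le_mean_mul_flipAt hI
  have h2 : a i ^ 2 * mean (halfspace a t) ≤ mean (fun x => excess a t x ^ 2) := by
    -- Of two neighbours above `t`, the higher one exceeds `t` by more than `2 |a i|`.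
    have key : ∀ x, 4 * a i ^ 2 * (halfspace a t x * halfspace a t (flipAt i x)) ≤
        excess a t x ^ 2 + excess a t (flipAt i x) ^ 2 := by
      intro x
      rcases halfspace_eq_zero_or_one a t x with hx | hx
      · simp only [hx, zero_mul, mul_zero]; positivity
      rcases halfspace_eq_zero_or_one a t (flipAt i x) with hy | hy
      · simp only [hy, mul_zero]; positivity
      have hx1 := lt_of_halfspace_eq_one hx
      have hy1 := lt_of_halfspace_eq_one hy
      rw [hx, hy]
      unfold excess
      rw [max_eq_left (by linarith), max_eq_left (by linarith)]
      rw [sum_flipAt] at hy1 ⊢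
      have h4 : (a i * ((x i : ℤ) : ℝ)) ^ 2 = a i ^ 2 := by rw [mul_pow, coord_sq, mul_one]
      rw [← h4]
      nlinarith [mul_pos (sub_pos.2 hx1) (sub_pos.2 hy1)]
    have h3 := mean_mono key
    rw [mean_const_mul, mean_add, mean_flipAt i fun x => excess a t x ^ 2] at h3
    nlinarith [sq_nonneg (a i)]
  have h3 := mean_excess_sq_le ha hE
  have h4 := mul_le_mul_of_nonneg_right h2 hL
  refine le_of_mul_le_mul_right ?_ hE
  linarith

/-! ### Lower bound for the threshold -/

lemma mean_exp {n : ℕ} (a : Fin n → ℝ) (l : ℝ) :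
    mean (fun x : Cube n => Real.exp (l * ∑ i, a i * ((x i : ℤ) : ℝ))) =
      ∏ i, Real.cosh (l * a i) := by
  have h1 : ∀ x : Cube n, Real.exp (l * ∑ i, a i * ((x i : ℤ) : ℝ)) =
      ∏ i, Real.exp (l * a i * ((x i : ℤ) : ℝ)) := by
    intro x
    rw [Finset.mul_sum, Real.exp_sum]
    simp only [mul_assoc]
  have h2 : ∀ i, ∑ u : ℤˣ, Real.exp (l * a i * ((u : ℤ) : ℝ)) = 2 * Real.cosh (l * a i) := by
    intro i
    rw [Real.cosh_eq]
    simp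
    ring
  unfold mean
  simp only [h1]
  rw [← Fintype.piFinset_univ, ← Finset.prod_univ_sum (fun _ : Fin n => (Finset.univ : Finset ℤˣ))
    fun i u => Real.exp (l * a i * ((u : ℤ) : ℝ))]
  simp only [h2]
  rw [Finset.prod_mul_distrib]
  simp

lemma exp_third_sq_le_cosh {y : ℝ} (hy : y ^ 2 ≤ 1) : Real.exp (y ^ 2 / 3) ≤ Real.cosh y := by
  have h1 : 1 + y ^ 2 / 2 ≤ Real.cosh y := by
    have h := sum_le_hasSum (Finset.range 2)
      (fun k _ => by rw [pow_mul]; positivity) (Real.hasSum_cosh y)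
    simpa [Finset.sum_range_succ] using h
  set v := y ^ 2 / 2 with hv
  have hv0 : 0 ≤ v := by positivity
  have h2 : Real.exp (v / (1 + v)) ≤ 1 + v := by
    have h3 := Real.add_one_le_exp (-(v / (1 + v)))
    have h4 : -(v / (1 + v)) + 1 = (1 + v)⁻¹ := by field_simp; ring
    rw [h4, Real.exp_neg] at h3
    exact (inv_le_inv₀ (by positivity) (Real.exp_pos _)).1 h3
  have h3 : y ^ 2 / 3 ≤ v / (1 + v) := by
    rw [le_div_iff₀ (by positivity)]
    nlinarith
  exact (Real.exp_le_exp.2 h3).trans (h2.trans h1)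

/-- Reverse Chernoff bound, by the Paley–Zygmund argument for `exp (l a · x)`. -/
lemma exp_le_four_mul_mean_halfspace {n : ℕ} {a : Fin n → ℝ} {t l : ℝ} (ha : ∑ i, a i ^ 2 = 1)
    (hl : 0 ≤ l) (hsmall : ∀ i, (l * a i) ^ 2 ≤ 1) (ht : l * t ≤ l ^ 2 / 3 - Real.log 2) :
    Real.exp (-(4 / 3 * l ^ 2)) ≤ 4 * mean (halfspace a t) := by
  set X : Cube n → ℝ := fun x => Real.exp (l * ∑ i, a i * ((x i : ℤ) : ℝ)) with hX
  have hsum : ∑ i, (l * a i) ^ 2 = l ^ 2 := by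
    simp only [mul_pow]
    rw [← Finset.mul_sum, ha, mul_one]
  have hlow : Real.exp (l ^ 2 / 3) ≤ mean X := by
    rw [hX, mean_exp, ← hsum, Finset.sum_div, Real.exp_sum]
    exact Finset.prod_le_prod (fun _ _ => (Real.exp_pos _).le)
      fun i _ => exp_third_sq_le_cosh (hsmall i)
  have hup : mean (fun x => X x ^ 2) ≤ Real.exp (2 * l ^ 2) := by
    have e : (fun x => X x ^ 2) =
        fun x : Cube n => Real.exp ((2 * l) * ∑ i, a i * ((x i : ℤ) : ℝ)) := by
      ext x
      rw [hX, ← Real.exp_nat_mul]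
      congr 1
      push_cast
      ring
    rw [e, mean_exp, ← hsum, Finset.mul_sum, Real.exp_sum]
    refine Finset.prod_le_prod (fun _ _ => (Real.cosh_pos _).le) fun i _ => ?_
    refine (Real.cosh_le_exp_half_sq _).trans_eq ?_
    congr 1
    ring
  have hsplit : mean X ≤ mean X / 2 + mean (fun x => X x * halfspace a t x) := by
    have e : ∀ x, X x ≤ mean X / 2 + X x * halfspace a t x := by
      intro x
      rcases halfspace_eq_zero_or_one a t x with h | h
      · have h1 : X x ≤ Real.exp (l ^ 2 / 3 - Real.log 2) :=
          Real.exp_le_exp.2 ((mul_le_mul_of_nonneg_left (le_of_halfspace_eq_zero h) hl).trans ht)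
        rw [Real.exp_sub, Real.exp_log two_pos] at h1
        rw [h]
        linarith
      · have : 0 < Real.exp (l ^ 2 / 3) := Real.exp_pos _
        rw [h]
        linarith
    have := mean_mono e
    rwa [mean_add, mean_const] at this
  have hcs := mean_mul_sq_le X (halfspace a t)
  simp only [halfspace_sq] at hcs
  have hE : 0 ≤ mean (halfspace a t) := mean_nonneg (halfspace_nonneg a t)
  have hpos : 0 < Real.exp (l ^ 2 / 3) := Real.exp_pos _
  have h1 : (Real.exp (l ^ 2 / 3) / 2) ^ 2 ≤ Real.exp (2 * l ^ 2) * mean (halfspace a t) :=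
    (pow_le_pow_left₀ (by positivity) (by linarith) 2).trans
      (hcs.trans (mul_le_mul_of_nonneg_right hup hE))
  have h2 : Real.exp (l ^ 2 / 3) ^ 2 =
      Real.exp (2 * l ^ 2) * Real.exp (-(4 / 3 * l ^ 2)) := by
    rw [← Real.exp_add, ← Real.exp_nat_mul]
    congr 1
    push_cast
    ring
  rw [div_pow, h2] at h1
  have h3 : 0 < Real.exp (2 * l ^ 2) := Real.exp_pos _
  refine le_of_mul_le_mul_left ?_ h3
  linarith

/-- If all weights are of order at most `‖a‖ / √(log (1 / E[f]))`, the threshold is at least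
of the order `‖a‖ √(log (1 / E[f]))` that it would have for Gaussian tails. -/
lemma sqrt_log_le_threshold {n : ℕ} {a : Fin n → ℝ} {t : ℝ} (ha : ∑ i, a i ^ 2 = 1)
    (hE : 0 < mean (halfspace a t)) (hL : 600 ≤ Real.log (1 / mean (halfspace a t)))
    (hsmall : ∀ i, a i ^ 2 * Real.log (1 / mean (halfspace a t)) ≤ 8) :
    √(Real.log (1 / mean (halfspace a t))) / 10 ≤ t := by
  set L := Real.log (1 / mean (halfspace a t)) with hLdef
  by_contra! hlt
  have hsq : √L ^ 2 = L := Real.sq_sqrt (by linarith)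
  have h24 : 24 ≤ √L := Real.le_sqrt_of_sq_le (by linarith)
  have hlog2 := Real.log_two_lt_d9
  have h1 : Real.exp (-(4 / 3 * (√L / 3) ^ 2)) ≤ 4 * mean (halfspace a t) := by
    refine exp_le_four_mul_mean_halfspace ha (by positivity) (fun i => ?_) ?_
    · rw [mul_pow, div_pow, hsq]
      linarith [hsmall i]
    · nlinarith
  have h2 : mean (halfspace a t) = Real.exp (-L) := by
    rw [hLdef, one_div, Real.log_inv, neg_neg, Real.exp_log hE]
  have h3 : (4 : ℝ) < Real.exp 2 := by
    have := Real.exp_one_gt_d9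
    have h4 : Real.exp 2 = Real.exp 1 * Real.exp 1 := by rw [← Real.exp_add]; norm_num
    nlinarith
  have h4 : 4 * mean (halfspace a t) < Real.exp (2 - L) := by
    rw [h2, sub_eq_add_neg, Real.exp_add]
    exact mul_lt_mul_of_pos_right h3 (Real.exp_pos _)
  have h5 := Real.exp_lt_exp.1 (h1.trans_lt h4)
  rw [div_pow, hsq] at h5
  linarith

/-! ### Elementary symmetric polynomials -/

/-- The elementary symmetric polynomial of degree `k` in the numbers `y i`, `i ∈ T`. -/
noncomputable def elemSymm {ι : Type*} (T : Finset ι) (y : ι → ℝ) (k : ℕ) : ℝ :=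
  ∑ S ∈ T.powersetCard k, ∏ i ∈ S, y i

lemma elemSymm_zero {ι : Type*} (T : Finset ι) (y : ι → ℝ) : elemSymm T y 0 = 1 := by
  simp [elemSymm]

lemma pow_succ_add_le_add_pow {P b : ℝ} (hP : 0 ≤ P) (hb : 0 ≤ b) (k : ℕ) :
    P ^ (k + 1) + (k + 1) * b * P ^ k ≤ (P + b) ^ (k + 1) := by
  induction k with
  | zero => simp
  | succ k ih =>
    have h := mul_le_mul_of_nonneg_right ih (add_nonneg hP hb)
    rw [← pow_succ] at h
    refine le_trans ?_ h
    have : 0 ≤ (k + 1) * (b * b) * P ^ k := by positivity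
    push_cast
    ring_nf at this ⊢
    linarith

/-- Maclaurin's inequality in its weakest form. -/
lemma elemSymm_le_pow_div_factorial {ι : Type*} (T : Finset ι) {b : ι → ℝ}
    (hb : ∀ i, 0 ≤ b i) (k : ℕ) :
    elemSymm T b k ≤ (∑ i ∈ T, b i) ^ k / k.factorial := by
  classical
  induction T using Finset.induction_on generalizing k with
  | empty =>
    cases k with
    | zero => simp [elemSymm]
    | succ k =>
      rw [elemSymm, Finset.powersetCard_eq_empty.2 (by simp)]
      simp
  | insert i T hi ih =>
    cases k with
    | zero => simp [elemSymm]
    | succ k =>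
      have hrec : elemSymm (insert i T) b (k + 1) =
          elemSymm T b (k + 1) + b i * elemSymm T b k := by
        unfold elemSymm
        rw [Finset.powersetCard_succ_insert hi, Finset.sum_union, Finset.sum_image,
          Finset.mul_sum]
        · congr 1
          refine Finset.sum_congr rfl fun S hS => ?_
          rw [Finset.prod_insert fun h => hi ((Finset.mem_powersetCard.1 hS).1 h)]
        · intro S hS S' hS' h
          have h1 : i ∉ S := fun h => hi ((Finset.mem_powersetCard.1 hS).1 h)
          have h2 : i ∉ S' := fun h => hi ((Finset.mem_powersetCard.1 hS').1 h)
          rw [← Finset.erase_insert h1, ← Finset.erase_insert h2, h]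
        · rw [Finset.disjoint_left]
          intro S hS hS'
          obtain ⟨S', -, rfl⟩ := Finset.mem_image.1 hS'
          exact hi ((Finset.mem_powersetCard.1 hS).1 (Finset.mem_insert_self _ _))
      set P := ∑ j ∈ T, b j with hP
      have hP0 : 0 ≤ P := Finset.sum_nonneg fun j _ => hb j
      rw [hrec, Finset.sum_insert hi, add_comm (b i)]
      have h1 := ih (k + 1)
      have h2 := mul_le_mul_of_nonneg_left (ih k) (hb i)
      have h3 := pow_succ_add_le_add_pow hP0 (hb i) k
      have h4 : (0 : ℝ) < k.factorial := by positivity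
      calc _ ≤ P ^ (k + 1) / ((k + 1).factorial : ℝ) + b i * (P ^ k / (k.factorial : ℝ)) := by
            linarith
        _ = (P ^ (k + 1) + (k + 1) * b i * P ^ k) / ((k + 1).factorial : ℝ) := by
            rw [Nat.factorial_succ]
            push_cast
            field_simp
        _ ≤ _ := by gcongr

/-- Newton's identity, with the term of the first power sum split off. -/
lemma newton_succ {n : ℕ} (y : Fin n → ℝ) (j : ℕ) :
    ((j : ℝ) + 1) * elemSymm Finset.univ y (j + 1) =
      (∑ i, y i) * elemSymm Finset.univ y j +
        ∑ m ∈ Finset.range j,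
          (-1) ^ (j + m) * elemSymm Finset.univ y m * ∑ i, y i ^ (j + 1 - m) := by
  have h := congrArg (MvPolynomial.aeval y) (MvPolynomial.mul_esymm_eq_sum (Fin n) ℝ (j + 1))
  have he : ∀ k, MvPolynomial.aeval y (MvPolynomial.esymm (Fin n) ℝ k) =
      elemSymm Finset.univ y k := by
    intro k
    simp [MvPolynomial.esymm, elemSymm]
  have hp : ∀ k, MvPolynomial.aeval y (MvPolynomial.psum (Fin n) ℝ k) = ∑ i, y i ^ k := by
    intro k
    simp [MvPolynomial.psum]
  simp only [map_mul, map_natCast, map_sum, map_pow, map_neg, map_one, he, hp] at h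
  rw [Finset.sum_filter, Finset.Nat.sum_antidiagonal_eq_sum_range_succ_mk,
    Finset.sum_range_succ] at h
  simp only [lt_irrefl, if_false, add_zero] at h
  have h2 : ∀ m ∈ Finset.range (j + 1),
      (if m < j + 1 then (-1) ^ m * elemSymm Finset.univ y m * ∑ i, y i ^ (j + 1 - m) else 0) =
        (-1) ^ m * elemSymm Finset.univ y m * ∑ i, y i ^ (j + 1 - m) := fun m hm =>
    if_pos (Finset.mem_range.1 hm)
  rw [Finset.sum_congr rfl h2, Finset.sum_range_succ, mul_add, Finset.mul_sum] at h
  push_cast at h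
  rw [h, add_comm]
  have hsgn : ((-1 : ℝ)) ^ (j + 1 + 1) = (-1) ^ j := by ring
  have hsq : ((-1 : ℝ)) ^ j * (-1) ^ j = 1 := by rw [← mul_pow]; norm_num
  congr 1
  · rw [hsgn, Nat.add_sub_cancel_left]
    simp only [pow_one]
    linear_combination (elemSymm Finset.univ y j * ∑ i, y i) * hsq
  · refine Finset.sum_congr rfl fun m _ => ?_
    rw [hsgn, pow_add]
    ring

/-- A sequence that nearly satisfies `(j + 1) e (j + 1) = s e j` stays above `(s / 2) ^ j / j!`,
as long as `j` is small compared with `s ^ 2` and with `s / α`. Here `T` collects the error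
terms, which are damped geometrically with ratio `α`. -/
lemma pow_div_factorial_le_of_recursion {e T : ℕ → ℝ} {s α : ℝ} {K : ℕ} (e0 : e 0 = 1)
    (T0 : T 0 = 0) (hT : ∀ j, T (j + 1) = α * T j + |e j|)
    (he : ∀ j : ℕ, s * e j - T j ≤ ((j : ℝ) + 1) * e (j + 1)) (hα : 0 ≤ α) (hs : 0 < s)
    (h1 : 8 * (α * K) ≤ s) (h2 : 16 * (K : ℝ) ≤ 3 * s ^ 2) :
    ∀ j ≤ K, (s / 2) ^ j / j.factorial ≤ e j ∧ T j ≤ s / 2 * e j := by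
  intro j
  induction j with
  | zero => intro _; simpa [e0, T0] using (half_pos hs).le
  | succ j ih =>
    intro hj
    obtain ⟨ih1, ih2⟩ := ih (by omega)
    have hej : 0 < e j := lt_of_lt_of_le (by positivity) ih1
    have hjK : (j : ℝ) + 1 ≤ K := by exact_mod_cast hj
    have hstep : s / 2 * e j ≤ ((j : ℝ) + 1) * e (j + 1) := by linarith [he j]
    have hlow : (s / 2) ^ (j + 1) / ((j + 1).factorial : ℝ) ≤ e (j + 1) := by
      have e1 : (s / 2) ^ (j + 1) / ((j + 1).factorial : ℝ) =
          s / 2 * ((s / 2) ^ j / (j.factorial : ℝ)) / ((j : ℝ) + 1) := by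
        rw [Nat.factorial_succ, pow_succ]
        push_cast
        field_simp
      rw [e1, div_le_iff₀ (by positivity)]
      calc _ ≤ s / 2 * e j := by gcongr
        _ ≤ _ := by linarith
    have hpos : 0 < e (j + 1) := lt_of_lt_of_le (by positivity) hlow
    refine ⟨hlow, ?_⟩
    rw [hT, abs_of_pos hej]
    have h3 : s / 2 * e j ≤ K * e (j + 1) :=
      hstep.trans (mul_le_mul_of_nonneg_right hjK hpos.le)
    have h4 : α * T j ≤ α * (K * e (j + 1)) :=
      mul_le_mul_of_nonneg_left (ih2.trans h3) hα
    have h5 : α * (K * e (j + 1)) ≤ s / 8 * e (j + 1) := by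
      rw [← mul_assoc]
      exact mul_le_mul_of_nonneg_right (by linarith) hpos.le
    have h6 : e j ≤ 3 * s / 8 * e (j + 1) := by
      have h7 : (K : ℝ) * e (j + 1) ≤ 3 * s ^ 2 / 16 * e (j + 1) :=
        mul_le_mul_of_nonneg_right (by linarith) hpos.le
      refine le_of_mul_le_mul_left ?_ (half_pos hs)
      calc _ ≤ _ := h3.trans h7
        _ = _ := by ring
    linarith

/-- When `∑ y i ^ 2 = 1` and no `y i` is large, the elementary symmetric polynomials of low
degree are governed by the sum `∑ y i`. -/
lemma pow_div_factorial_le_elemSymm {n : ℕ} {y : Fin n → ℝ} {α : ℝ} {k : ℕ}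
    (hy : ∑ i, y i ^ 2 = 1) (hα : ∀ i, |y i| ≤ α) (hα0 : 0 ≤ α) (hs : 0 < ∑ i, y i)
    (h1 : 8 * (α * k) ≤ ∑ i, y i) (h2 : 16 * (k : ℝ) ≤ 3 * (∑ i, y i) ^ 2) :
    ((∑ i, y i) / 2) ^ k / k.factorial ≤ elemSymm Finset.univ y k := by
  have hpsum : ∀ m, |∑ i, y i ^ (m + 2)| ≤ α ^ m := by
    intro m
    calc |∑ i, y i ^ (m + 2)| ≤ ∑ i, |y i ^ (m + 2)| := Finset.abs_sum_le_sum_abs _ _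
      _ ≤ ∑ i, α ^ m * y i ^ 2 := by
          refine Finset.sum_le_sum fun i _ => ?_
          rw [pow_add, abs_mul, abs_pow, abs_of_nonneg (sq_nonneg (y i))]
          gcongr
          exact hα i
      _ = α ^ m := by rw [← Finset.mul_sum, hy, mul_one]
  refine (pow_div_factorial_le_of_recursion (e := elemSymm Finset.univ y)
    (T := fun j => ∑ m ∈ Finset.range j, α ^ (j - 1 - m) * |elemSymm Finset.univ y m|)
    (elemSymm_zero _ _) (by simp) (fun j => ?_) (fun j => ?_) hα0 hs h1 h2 k le_rfl).1
  · simp only [Nat.add_sub_cancel]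
    rw [Finset.sum_range_succ, Finset.mul_sum]
    congr 1
    · refine Finset.sum_congr rfl fun m hm => ?_
      have hm' := Finset.mem_range.1 hm
      rw [← mul_assoc, ← pow_succ', show j - 1 - m + 1 = j - m by omega]
    · simp
  · rw [newton_succ, sub_eq_add_neg]
    gcongr
    refine (abs_le.1 ((Finset.abs_sum_le_sum_abs _ _).trans (Finset.sum_le_sum fun m hm => ?_))).1
    have hm' := Finset.mem_range.1 hm
    rw [abs_mul, abs_mul, abs_pow, abs_neg, abs_one, one_pow, one_mul, mul_comm,
      show j + 1 - m = (j - 1 - m) + 2 by omega]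
    gcongr
    exact hpsum _

/-! ### Lower bound for the weight -/

/-- Test `f` against the elementary symmetric polynomial of degree `k` in the `a i * x i`. -/
lemma weight_ge_of_threshold {n : ℕ} {a : Fin n → ℝ} {t α : ℝ} {k : ℕ}
    (ha : ∑ i, a i ^ 2 = 1) (hα : ∀ i, |a i| ≤ α) (hα0 : 0 ≤ α) (ht : 0 < t)
    (h1 : 8 * (α * k) ≤ t) (h2 : 16 * (k : ℝ) ≤ 3 * t ^ 2) :
    (t ^ 2 / 4) ^ k / k.factorial * mean (halfspace a t) ^ 2 ≤ weight k (halfspace a t) := by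
  set Q : Cube n → ℝ := fun x => elemSymm Finset.univ (fun i => a i * ((x i : ℤ) : ℝ)) k with hQ
  have hlow : (t / 2) ^ k / k.factorial * mean (halfspace a t) ≤
      mean (fun x => halfspace a t x * Q x) := by
    rw [← mean_const_mul]
    refine mean_mono fun x => ?_
    rcases halfspace_eq_zero_or_one a t x with h | h
    · simp [h]
    have hx := lt_of_halfspace_eq_one h
    rw [h, mul_one, one_mul]
    refine le_trans ?_ (pow_div_factorial_le_elemSymm (α := α) ?_ ?_ hα0 (ht.trans hx)
      (h1.trans hx.le) (h2.trans ?_))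
    · gcongr
    · simpa only [mul_pow, coord_sq, mul_one] using ha
    · intro i
      rcases Int.units_eq_one_or (x i) with h | h <;> simpa [h] using hα i
    · gcongr
  have hfour : mean (fun x => halfspace a t x * Q x) =
      ∑ S ∈ (Finset.univ : Finset (Fin n)).powersetCard k,
        (∏ i ∈ S, a i) * fourierCoefficient (halfspace a t) S := by
    simp only [fourierCoefficient, ← mean_const_mul]
    rw [← mean_sum]
    congr 1
    ext x
    rw [hQ]
    simp only [elemSymm, chi, Finset.mul_sum, Finset.prod_mul_distrib]
    refine Finset.sum_congr rfl fun S _ => ?_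
    ring
  have hcs : mean (fun x => halfspace a t x * Q x) ^ 2 ≤
      1 / k.factorial * weight k (halfspace a t) := by
    rw [hfour]
    refine (Finset.sum_mul_sq_le_sq_mul_sq _ _ _).trans ?_
    have h3 := elemSymm_le_pow_div_factorial (Finset.univ : Finset (Fin n))
      (b := fun i => a i ^ 2) (fun i => sq_nonneg _) k
    rw [ha, one_pow] at h3
    refine mul_le_mul_of_nonneg_right (le_trans (le_of_eq ?_) h3)
      (Finset.sum_nonneg fun _ _ => sq_nonneg _)
    simp only [elemSymm, Finset.prod_pow]
  have hE : 0 ≤ mean (halfspace a t) := mean_nonneg (halfspace_nonneg a t)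
  have h3 := (pow_le_pow_left₀ (by positivity) hlow 2).trans hcs
  have hk : (0 : ℝ) < k.factorial := by positivity
  have h4 : (t ^ 2 / 4) ^ k = ((t / 2) ^ k) ^ 2 := by
    rw [← pow_mul, mul_comm k 2, pow_mul]; congr 1; ring
  rw [h4]
  rw [mul_pow, div_pow, one_div, inv_mul_eq_div, le_div_iff₀ hk] at h3
  refine le_trans (le_of_eq ?_) h3
  field_simp

/-! ### Hypercontractivity and the level-`k` inequality -/

lemma choose_two_mul_le (r j : ℕ) (hr : 1 ≤ r) :
    ((2 * r).choose (2 * j) : ℝ) ≤ r.choose j * (2 * r - 1 : ℝ) ^ j := by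
  have hr' : (1 : ℝ) ≤ r := by exact_mod_cast hr
  induction j with
  | zero => simp
  | succ j ih =>
    rcases le_or_gt r j with h | h
    · rw [Nat.choose_eq_zero_of_lt (by omega)]
      have : (0 : ℝ) ≤ 2 * r - 1 := by linarith
      simp only [Nat.cast_zero]
      positivity
    have hj : (j : ℝ) + 1 ≤ r := by exact_mod_cast h
    have e1 : ((2 * r).choose (2 * j + 1) : ℝ) * (2 * j + 1) =
        (2 * r).choose (2 * j) * (2 * r - 2 * j) := by
      have := Nat.choose_succ_right_eq (2 * r) (2 * j)
      have := congrArg (Nat.cast (R := ℝ)) this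
      push_cast [Nat.cast_sub (show 2 * j ≤ 2 * r by omega)] at this
      exact this
    have e2 : ((2 * r).choose (2 * (j + 1)) : ℝ) * (2 * j + 2) =
        (2 * r).choose (2 * j + 1) * (2 * r - 2 * j - 1) := by
      have := Nat.choose_succ_right_eq (2 * r) (2 * j + 1)
      have := congrArg (Nat.cast (R := ℝ)) this
      push_cast [Nat.cast_sub (show 2 * j + 1 ≤ 2 * r by omega)] at this
      rw [show 2 * (j + 1) = 2 * j + 1 + 1 by ring]
      linarith
    have e3 : (r.choose (j + 1) : ℝ) * (j + 1) = r.choose j * (r - j) := by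
      have := Nat.choose_succ_right_eq r j
      have := congrArg (Nat.cast (R := ℝ)) this
      push_cast [Nat.cast_sub h.le] at this
      exact this
    have hpos : (0 : ℝ) < (2 * j + 2) * (2 * j + 1) := by positivity
    refine le_of_mul_le_mul_right ?_ hpos
    calc ((2 * r).choose (2 * (j + 1)) : ℝ) * ((2 * j + 2) * (2 * j + 1))
        = (2 * r).choose (2 * j) * ((2 * r - 2 * j) * (2 * r - 2 * j - 1)) := by
          linear_combination (2 * (j : ℝ) + 1) * e2 + (2 * (r : ℝ) - 2 * j - 1) * e1
      _ ≤ r.choose j * (2 * r - 1 : ℝ) ^ j * ((2 * r - 2 * j) * ((2 * r - 1) * (2 * j + 1))) := by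
          have hj0 : (0 : ℝ) ≤ j := by positivity
          have h5 : (0 : ℝ) ≤ 2 * r - 2 * j - 1 := by linarith
          have h6 : (0 : ℝ) ≤ 2 * r - 1 := by linarith
          have h8 : (0 : ℝ) ≤ 2 * r - 2 * j := by linarith
          have h7 : (2 * r - 2 * j - 1 : ℝ) ≤ (2 * r - 1) * (2 * j + 1) := by nlinarith
          gcongr
      _ = r.choose (j + 1) * (2 * r - 1 : ℝ) ^ (j + 1) * ((2 * j + 2) * (2 * j + 1)) := by
          rw [pow_succ]
          linear_combination
            (-(2 * (2 * (r : ℝ) - 1) ^ j * (2 * r - 1) * (2 * j + 1))) * e3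

lemma sum_range_two_mul_add_one (F : ℕ → ℝ) (r : ℕ) :
    ∑ m ∈ Finset.range (2 * r + 1), F m =
      ∑ j ∈ Finset.range (r + 1), F (2 * j) + ∑ j ∈ Finset.range r, F (2 * j + 1) := by
  induction r with
  | zero => simp
  | succ r ih =>
    rw [show 2 * (r + 1) + 1 = 2 * r + 1 + 1 + 1 by ring]
    simp only [Finset.sum_range_succ] at ih ⊢
    rw [show 2 * (r + 1) = 2 * r + 1 + 1 by ring]
    linarith

/-- The two-point hypercontractive inequality for the exponents `2` and `2 r`. -/
lemma two_point_hypercontractive (h g : ℝ) {r : ℕ} (hr : 1 ≤ r) :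
    ((h + g) ^ (2 * r) + (h - g) ^ (2 * r)) / 2 ≤ (h ^ 2 + (2 * r - 1) * g ^ 2) ^ r := by
  have e : ((h + g) ^ (2 * r) + (h - g) ^ (2 * r)) / 2 =
      ∑ j ∈ Finset.range (r + 1), (g ^ 2) ^ j * (h ^ 2) ^ (r - j) * (2 * r).choose (2 * j) := by
    rw [add_comm h g, show h - g = -g + h by ring, add_pow, add_pow, sum_range_two_mul_add_one,
      sum_range_two_mul_add_one]
    have hodd : ∑ j ∈ Finset.range r, (-g) ^ (2 * j + 1) * h ^ (2 * r - (2 * j + 1)) *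
          ((2 * r).choose (2 * j + 1) : ℝ) =
        -∑ j ∈ Finset.range r, g ^ (2 * j + 1) * h ^ (2 * r - (2 * j + 1)) *
          ((2 * r).choose (2 * j + 1) : ℝ) := by
      rw [← Finset.sum_neg_distrib]
      refine Finset.sum_congr rfl fun j _ => ?_
      rw [Odd.neg_pow ⟨j, rfl⟩]
      ring
    have heven : ∀ g : ℝ, ∑ j ∈ Finset.range (r + 1), g ^ (2 * j) * h ^ (2 * r - 2 * j) *
          ((2 * r).choose (2 * j) : ℝ) =
        ∑ j ∈ Finset.range (r + 1), (g ^ 2) ^ j * (h ^ 2) ^ (r - j) *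
          ((2 * r).choose (2 * j) : ℝ) := by
      intro g
      refine Finset.sum_congr rfl fun j _ => ?_
      rw [← Nat.mul_sub, pow_mul, pow_mul]
    rw [hodd, heven, heven, neg_sq]
    ring
  rw [e, add_comm (h ^ 2), add_pow]
  refine Finset.sum_le_sum fun j _ => ?_
  rw [mul_pow]
  calc _ ≤ (g ^ 2) ^ j * (h ^ 2) ^ (r - j) * (r.choose j * (2 * r - 1 : ℝ) ^ j) := by
        gcongr
        exact choose_two_mul_le r j hr
    _ = _ := by ring

/-- Minkowski's inequality in `L^r`, for integral `r`. -/
lemma mean_add_pow_le {n : ℕ} {u v : Cube n → ℝ} {H G : ℝ} {r : ℕ}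
    (hu : ∀ x, 0 ≤ u x) (hv : ∀ x, 0 ≤ v x) (hH : 0 ≤ H) (hG : 0 ≤ G) (hr : 1 ≤ r)
    (huH : mean (fun x => u x ^ r) ≤ H ^ r) (hvG : mean (fun x => v x ^ r) ≤ G ^ r) :
    mean (fun x => (u x + v x) ^ r) ≤ (H + G) ^ r := by
  have hr0 : r ≠ 0 := by omega
  have hzero : ∀ w : Cube n → ℝ, (∀ x, 0 ≤ w x) → mean (fun x => w x ^ r) ≤ 0 → ∀ x, w x = 0 :=
    fun w hw h x => pow_eq_zero_iff hr0 |>.1 <|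
      eq_zero_of_mean_eq_zero (fun x => pow_nonneg (hw x) r)
        (h.antisymm (mean_nonneg fun x => pow_nonneg (hw x) r)) x
  rcases hH.eq_or_lt with h0 | hH
  · have := hzero u hu (by simpa [← h0, hr0] using huH)
    simpa [this, ← h0] using hvG
  rcases hG.eq_or_lt with h0 | hG
  · have := hzero v hv (by simpa [← h0, hr0] using hvG)
    simpa [this, ← h0] using huH
  have hM : 0 < H + G := by positivity
  -- Convexity with weights `H / (H + G)`, `G / (H + G)` at the points
  -- `u (H + G) / H`, `v (H + G) / G`.
  have key : ∀ x, (u x + v x) ^ r ≤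
      (H + G) ^ r * (H / (H + G) / H ^ r) * u x ^ r +
        (H + G) ^ r * (G / (H + G) / G ^ r) * v x ^ r := by
    intro x
    have hx : u x * (H + G) / H ∈ Set.Ici (0 : ℝ) := by
      have := hu x
      simp only [Set.mem_Ici]
      positivity
    have hy : v x * (H + G) / G ∈ Set.Ici (0 : ℝ) := by
      have := hv x
      simp only [Set.mem_Ici]
      positivity
    have h := (convexOn_pow r).2 hx hy (show 0 ≤ H / (H + G) by positivity)
      (show 0 ≤ G / (H + G) by positivity) (by field_simp)
    simp only [smul_eq_mul] at h
    have e1 : H / (H + G) * (u x * (H + G) / H) + G / (H + G) * (v x * (H + G) / G) =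
        u x + v x := by field_simp
    rw [e1] at h
    refine h.trans_eq ?_
    rw [div_pow, div_pow, mul_pow, mul_pow]
    ring
  refine (mean_mono key).trans ?_
  rw [mean_add, mean_const_mul, mean_const_mul]
  calc _ ≤ (H + G) ^ r * (H / (H + G) / H ^ r) * H ^ r +
        (H + G) ^ r * (G / (H + G) / G ^ r) * G ^ r := by gcongr
    _ = _ := by field_simp

lemma chi_insert {n : ℕ} {i : Fin n} {S : Finset (Fin n)} (hi : i ∉ S) (x : Cube n) :
    chi (insert i S) x = ((x i : ℤ) : ℝ) * chi S x := by
  rw [chi, Finset.prod_insert hi, chi]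

lemma chi_flipAt {n : ℕ} {i : Fin n} {S : Finset (Fin n)} (hi : i ∉ S) (x : Cube n) :
    chi S (flipAt i x) = chi S x := by
  unfold chi
  refine Finset.prod_congr rfl fun j hj => ?_
  rw [flipAt, Function.update_of_ne (ne_of_mem_of_not_mem hj hi)]

/-- Bonami's hypercontractive inequality for the exponents `2` and `2 r`. -/
theorem mean_even_pow_le {n : ℕ} {r : ℕ} (hr : 1 ≤ r) (T : Finset (Fin n))
    (c : Finset (Fin n) → ℝ) :
    mean (fun x => (∑ S ∈ T.powerset, c S * chi S x) ^ (2 * r)) ≤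
      (∑ S ∈ T.powerset, (2 * r - 1 : ℝ) ^ S.card * c S ^ 2) ^ r := by
  have hr' : (1 : ℝ) ≤ r := by exact_mod_cast hr
  have hK : (0 : ℝ) ≤ 2 * r - 1 := by linarith
  induction T using Finset.induction_on generalizing c with
  | empty => simp [chi, mean_const, pow_mul]
  | insert i T hi ih =>
    have hnot : ∀ S ∈ T.powerset, i ∉ S := fun S hS h => hi (Finset.mem_powerset.1 hS h)
    set h : Cube n → ℝ := fun x => ∑ S ∈ T.powerset, c S * chi S x with hh
    set g : Cube n → ℝ := fun x => ∑ S ∈ T.powerset, c (insert i S) * chi S x with hg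
    have hsplit : ∀ x, ∑ S ∈ (insert i T).powerset, c S * chi S x =
        h x + ((x i : ℤ) : ℝ) * g x := by
      intro x
      rw [Finset.sum_powerset_insert hi, hh, hg, Finset.mul_sum]
      congr 1
      refine Finset.sum_congr rfl fun S hS => ?_
      rw [chi_insert (hnot S hS)]
      ring
    have hflip : ∀ x, h (flipAt i x) = h x ∧ g (flipAt i x) = g x := by
      intro x
      constructor <;>
      · refine Finset.sum_congr rfl fun S hS => ?_
        rw [chi_flipAt (hnot S hS)]
    have hnorm : ∑ S ∈ (insert i T).powerset, (2 * r - 1 : ℝ) ^ S.card * c S ^ 2 =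
        ∑ S ∈ T.powerset, (2 * r - 1 : ℝ) ^ S.card * c S ^ 2 +
          (2 * r - 1) * ∑ S ∈ T.powerset, (2 * r - 1 : ℝ) ^ S.card * c (insert i S) ^ 2 := by
      rw [Finset.sum_powerset_insert hi, Finset.mul_sum]
      congr 1
      refine Finset.sum_congr rfl fun S hS => ?_
      rw [Finset.card_insert_of_notMem (hnot S hS), pow_succ]
      ring
    simp only [hsplit]
    rw [hnorm]
    have hsym : mean (fun x => (h x + ((x i : ℤ) : ℝ) * g x) ^ (2 * r)) =
        mean (fun x => ((h x + ((x i : ℤ) : ℝ) * g x) ^ (2 * r) +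
          (h x - ((x i : ℤ) : ℝ) * g x) ^ (2 * r)) / 2) := by
      have e : mean (fun x => (h x - ((x i : ℤ) : ℝ) * g x) ^ (2 * r)) =
          mean (fun x => (h x + ((x i : ℤ) : ℝ) * g x) ^ (2 * r)) := by
        rw [← mean_flipAt i]
        congr 1
        ext x
        rw [(hflip x).1, (hflip x).2]
        simp [flipAt]
      simp only [div_eq_inv_mul]
      rw [mean_const_mul, mean_add, e]
      ring
    rw [hsym]
    have hpt : ∀ x, ((h x + ((x i : ℤ) : ℝ) * g x) ^ (2 * r) +
        (h x - ((x i : ℤ) : ℝ) * g x) ^ (2 * r)) / 2 ≤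
          (h x ^ 2 + (2 * r - 1) * g x ^ 2) ^ r := by
      intro x
      have := two_point_hypercontractive (h x) (((x i : ℤ) : ℝ) * g x) hr
      rwa [mul_pow _ (g x) 2, coord_sq, one_mul] at this
    refine (mean_mono hpt).trans
      (mean_add_pow_le (fun x => sq_nonneg _) (fun x => by positivity) ?_ ?_ hr ?_ ?_)
    · exact Finset.sum_nonneg fun S _ => by positivity
    · exact mul_nonneg hK (Finset.sum_nonneg fun S _ => by positivity)
    · simp only [← pow_mul]
      exact ih c
    · simp only [mul_pow, ← pow_mul]
      rw [mean_const_mul]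
      exact mul_le_mul_of_nonneg_left (ih fun S => c (insert i S)) (by positivity)

/-- Jensen's inequality for the even power `2 r` and the uniform measure on `{f = 1}`. -/
lemma mean_mul_pow_le {n : ℕ} {f p : Cube n → ℝ} (hf : ∀ x, f x = 0 ∨ f x = 1)
    (hE : 0 < mean f) (r : ℕ) :
    (mean (fun x => f x * p x) / mean f) ^ (2 * r) ≤ mean (fun x => p x ^ (2 * r)) / mean f := by
  have hsum : ∑ x, f x = 2 ^ n * mean f := by rw [mean]; field_simp
  have hf0 : ∀ x, 0 ≤ f x := fun x => by rcases hf x with h | h <;> simp [h]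
  have h := Real.pow_arith_mean_le_arith_mean_pow_of_even Finset.univ
    (fun x => f x / (2 ^ n * mean f)) p
    (fun x _ => div_nonneg (hf0 x) (by positivity))
    (by rw [← Finset.sum_div, hsum, div_self (by positivity)]) (n := 2 * r) ⟨r, two_mul r⟩
  have e : ∀ q : Cube n → ℝ, ∑ x, f x / (2 ^ n * mean f) * q x =
      mean (fun x => f x * q x) / mean f := by
    intro q
    rw [mean.eq_def fun x => f x * q x, div_div, Finset.sum_div]
    exact Finset.sum_congr rfl fun x _ => by ring
  rw [e, e fun x => p x ^ (2 * r)] at h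
  refine h.trans ?_
  gcongr
  refine mean_mono fun x => ?_
  have h1 : 0 ≤ p x ^ (2 * r) := by rw [pow_mul]; positivity
  rcases hf x with h | h <;> simp [h, h1]

lemma weight_nonneg {n : ℕ} (k : ℕ) (f : Cube n → ℝ) : 0 ≤ weight k f :=
  Finset.sum_nonneg fun _ _ => sq_nonneg _

/-- The level-`k` inequality before the choice of the exponent `2 r`: pair `f` with its own
level-`k` part `p`, whose mean against `f` is the weight, and bound the `2 r`-th moment of `p`. -/
lemma weight_pow_le {n : ℕ} {f : Cube n → ℝ} (hf : ∀ x, f x = 0 ∨ f x = 1) (hE : 0 < mean f)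
    (k : ℕ) {r : ℕ} (hr : 1 ≤ r) :
    weight k f ^ r ≤ ((2 * r - 1 : ℝ) ^ k * mean f ^ 2) ^ r * (1 / mean f) := by
  have hr' : (1 : ℝ) ≤ r := by exact_mod_cast hr
  have hK : (0 : ℝ) ≤ 2 * r - 1 := by linarith
  rcases (weight_nonneg k f).eq_or_lt with h0 | hW
  · rw [← h0, zero_pow (by omega)]
    positivity
  set p : Cube n → ℝ := fun x =>
    ∑ S ∈ (Finset.univ : Finset (Fin n)).powersetCard k, fourierCoefficient f S * chi S x with hp
  have hfp : mean (fun x => f x * p x) = weight k f := by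
    rw [hp, weight]
    simp only [Finset.mul_sum]
    rw [mean_sum]
    refine Finset.sum_congr rfl fun S _ => ?_
    rw [sq]
    nth_rewrite 3 [fourierCoefficient]
    rw [← mean_const_mul]
    congr 1
    ext x
    ring
  have hmom : mean (fun x => p x ^ (2 * r)) ≤ ((2 * r - 1 : ℝ) ^ k * weight k f) ^ r := by
    have h := mean_even_pow_le hr (Finset.univ : Finset (Fin n))
      (fun S => if S.card = k then fourierCoefficient f S else 0)
    simp only [ite_mul, zero_mul, ite_pow, mul_ite, ne_eq, OfNat.ofNat_ne_zero,
      not_false_eq_true, zero_pow, mul_zero, ← Finset.sum_filter,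
      ← Finset.powersetCard_eq_filter] at h
    refine h.trans_eq ?_
    rw [weight, Finset.mul_sum]
    congr 1
    refine Finset.sum_congr rfl fun S hS => ?_
    rw [(Finset.mem_powersetCard.1 hS).2]
  have h := (mean_mul_pow_le hf hE r (p := p)).trans
    (div_le_div_of_nonneg_right hmom hE.le)
  rw [hfp, div_pow, div_le_iff₀ (by positivity)] at h
  have hWr : 0 < weight k f ^ r := by positivity
  refine le_of_mul_le_mul_right ?_ hWr
  calc weight k f ^ r * weight k f ^ r = weight k f ^ (2 * r) := by rw [two_mul, pow_add]
    _ ≤ _ := h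
    _ = _ := by
      rw [mul_pow, mul_pow, ← pow_mul (mean f)]
      ring

/-- The level-`k` inequality, for functions of mean at most `1 / e`. -/
lemma weight_le {n : ℕ} {f : Cube n → ℝ} (hf : ∀ x, f x = 0 ∨ f x = 1) (hE : 0 < mean f)
    (hL : 1 ≤ Real.log (1 / mean f)) (k : ℕ) :
    weight k f ≤ Real.exp 1 * 3 ^ k * mean f ^ 2 * Real.log (1 / mean f) ^ k := by
  set L := Real.log (1 / mean f) with hLdef
  -- The exponent `2 r` of order `log (1 / E[f])` makes `E[f] ^ (1 / r)` bounded below.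
  set r := ⌈L⌉₊ with hrdef
  have hrL : L ≤ r := Nat.le_ceil L
  have hrL2 : (r : ℝ) < L + 1 := Nat.ceil_lt_add_one (by linarith)
  have hr : 1 ≤ r := by
    have : (1 : ℝ) ≤ r := hL.trans hrL
    exact_mod_cast this
  have hr' : (1 : ℝ) ≤ r := by exact_mod_cast hr
  have hK : (0 : ℝ) ≤ 2 * r - 1 := by linarith
  have h1 := weight_pow_le hf hE k hr
  have h2 : 1 / mean f ≤ Real.exp 1 ^ r := by
    rw [← Real.exp_nat_mul, mul_one, ← Real.exp_log (show 0 < 1 / mean f by positivity)]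
    exact Real.exp_le_exp.2 hrL
  have h3 : weight k f ^ r ≤ ((2 * r - 1 : ℝ) ^ k * mean f ^ 2 * Real.exp 1) ^ r := by
    rw [mul_pow _ (Real.exp 1)]
    exact h1.trans (mul_le_mul_of_nonneg_left h2 (by positivity))
  have h4 := le_of_pow_le_pow_left₀ (by omega) (by positivity) h3
  refine h4.trans ?_
  calc (2 * r - 1 : ℝ) ^ k * mean f ^ 2 * Real.exp 1
      ≤ (3 * L) ^ k * mean f ^ 2 * Real.exp 1 := by
        gcongr
        linarith
    _ = _ := by rw [mul_pow]; ring

/-! ### Bounds in terms of the mean -/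

lemma halfspace_div {n : ℕ} (a : Fin n → ℝ) (t : ℝ) {s : ℝ} (hs : 0 < s) :
    halfspace (fun i => a i / s) (t / s) = halfspace a t := by
  ext x
  have e : ∑ i, a i / s * ((x i : ℤ) : ℝ) = (∑ i, a i * ((x i : ℤ) : ℝ)) / s := by
    rw [Finset.sum_div]
    exact Finset.sum_congr rfl fun i _ => by ring
  simp only [halfspace, e, gt_iff_lt, div_lt_div_iff_of_pos_right hs]

lemma weight_ge_of_sum_sq_eq_one {k n : ℕ} {a : Fin n → ℝ} {t : ℝ} {i₀ : Fin n}
    (ha : ∑ i, a i ^ 2 = 1) (hmax : ∀ i, |a i| ≤ |a i₀|)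
    (hk : 1 ≤ k) (hE : 0 < mean (halfspace a t))
    (hL : 689 * (k : ℝ) ≤ Real.log (1 / mean (halfspace a t)))
    (hI : influence (halfspace a t) i₀ ≤ mean (halfspace a t)) :
    (Real.log (1 / mean (halfspace a t)) / 400) ^ k / k.factorial * mean (halfspace a t) ^ 2 ≤
      weight k (halfspace a t) := by
  have hk' : (1 : ℝ) ≤ k := by exact_mod_cast hk
  have h0 := sq_weight_mul_log_le ha hE (by linarith) hI
  have ht := sqrt_log_le_threshold ha hE (by linarith) fun i =>
    (mul_le_mul_of_nonneg_right (sq_le_sq.2 (hmax i)) (by linarith)).trans h0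
  set L := Real.log (1 / mean (halfspace a t)) with hLdef
  have hL0 : 0 < L := by linarith
  have hsq : √L ^ 2 = L := Real.sq_sqrt hL0.le
  have hsqpos : 0 < √L := Real.sqrt_pos.2 hL0
  have ht0 : 0 < t := lt_of_lt_of_le (by positivity) ht
  have ht2 : L / 100 ≤ t ^ 2 := by
    have := pow_le_pow_left₀ (by positivity) ht 2
    rw [div_pow, hsq] at this
    linarith
  have hα : |a i₀| * √L ≤ 3 := by
    refine abs_le_of_sq_le_sq' ?_ (by norm_num) |>.2
    rw [mul_pow, sq_abs, hsq]
    linarith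
  have h1 : 8 * (|a i₀| * k) ≤ t := by
    have h2 : |a i₀| * k ≤ |a i₀| * (L / 689) :=
      mul_le_mul_of_nonneg_left (by linarith) (abs_nonneg _)
    have h3 : |a i₀| * (L / 689) = |a i₀| * √L * √L / 689 := by
      rw [mul_assoc, ← sq, hsq, mul_div_assoc]
    have h4 := mul_le_mul_of_nonneg_right hα hsqpos.le
    linarith
  refine le_trans ?_
    (weight_ge_of_threshold ha hmax (abs_nonneg _) ht0 h1 (by linarith))
  have : L / 400 ≤ t ^ 2 / 4 := by linarith
  gcongr

/-- The lower bound without the factor `log (2 k)`, under the weaker hypothesis that the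
influence of a coordinate of largest weight is at most the mean. -/
lemma weight_ge_of_influence_le {k n : ℕ} {a : Fin n → ℝ} {t : ℝ} {i₀ : Fin n}
    (hmax : ∀ i, |a i| ≤ |a i₀|) (hk : 1 ≤ k)
    (hE : mean (halfspace a t) < (2 : ℝ) ^ (-(999 * k : ℤ)))
    (hI : influence (halfspace a t) i₀ ≤ mean (halfspace a t)) :
    (Real.log (1 / mean (halfspace a t)) / 400) ^ k / k.factorial * mean (halfspace a t) ^ 2 ≤
      weight k (halfspace a t) := by
  have hk' : (1 : ℝ) ≤ k := by exact_mod_cast hk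
  rcases (mean_nonneg (halfspace_nonneg a t)).eq_or_lt with h0 | h0
  · rw [← h0]
    simpa using weight_nonneg k _
  have hlog := Real.log_lt_log h0 hE
  rw [Real.log_zpow] at hlog
  push_cast at hlog
  have hlog2 := Real.log_two_gt_d9
  have hL : 689 * (k : ℝ) ≤ Real.log (1 / mean (halfspace a t)) := by
    rw [one_div, Real.log_inv]
    nlinarith
  have hσ : 0 < ∑ i, a i ^ 2 := by
    refine (Finset.sum_nonneg fun i _ => sq_nonneg (a i)).lt_of_ne' fun h => ?_
    -- With zero weights the halfspace is constant.
    have hz : ∀ i, a i = 0 := fun i => by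
      have := (Finset.sum_eq_zero_iff_of_nonneg fun i _ => sq_nonneg (a i)).1 h i
        (Finset.mem_univ i)
      exact pow_eq_zero_iff two_ne_zero |>.1 this
    have hconst : ∀ x, halfspace a t x = if 0 > t then 1 else 0 := fun x => by
      simp [halfspace, hz]
    have hm : mean (halfspace a t) = if 0 > t then 1 else 0 := by
      rw [funext hconst, mean_const]
    rw [hm] at hL h0
    split_ifs at hL h0
    · norm_num at hL
      linarith
    · exact lt_irrefl _ h0
  have hs := Real.sqrt_pos.2 hσ
  have e := halfspace_div a t hs
  rw [← e] at hI h0 hL ⊢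
  refine weight_ge_of_sum_sq_eq_one (i₀ := i₀) ?_ (fun i => ?_) hk h0 hL hI
  · simp only [div_pow]
    rw [← Finset.sum_div, Real.sq_sqrt hσ.le, div_self hσ.ne']
  · rw [abs_div, abs_div]
    exact div_le_div_of_nonneg_right (hmax i) (abs_nonneg _)

lemma weight_eq_zero {n : ℕ} {f : Cube n → ℝ} (h : ∀ x, f x = 0) (k : ℕ) : weight k f = 0 := by
  simp [weight, fourierCoefficient, h, mean]

end BooleanCube

theorem theorem2 :
    (∃ c₁ c₂ : ℝ, 0 < c₁ ∧ 0 < c₂ ∧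
      ∀ k : ℕ, 1 ≤ k → ∀ (n : ℕ) (a : Fin n → ℝ) (t : ℝ) (i₀ : Fin n),
        (∀ i, |a i| ≤ |a i₀|) →
        BooleanCube.mean (BooleanCube.halfspace a t) < (2 : ℝ) ^ (-(999 * k : ℤ)) →
        BooleanCube.influence (BooleanCube.halfspace a t) i₀
          ≤ c₁ * BooleanCube.mean (BooleanCube.halfspace a t) / k →
        BooleanCube.weight k (BooleanCube.halfspace a t)
          ≥ (c₂ * Real.log (2 * k)) ^ (-(k : ℤ)) / (Nat.factorial k : ℝ)
            * BooleanCube.mean (BooleanCube.halfspace a t) ^ 2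
            * Real.log (1 / BooleanCube.mean (BooleanCube.halfspace a t)) ^ k) ∧
    (∀ k : ℕ, 1 ≤ k → ∃ c₁ c₂ c₃ c₄ : ℝ, 0 < c₁ ∧ 0 < c₂ ∧ 0 < c₃ ∧ 0 < c₄ ∧
      ∀ (n : ℕ) (a : Fin n → ℝ) (t : ℝ),
        BooleanCube.mean (BooleanCube.halfspace a t) ≤ c₁ →
        BooleanCube.maxInfluence (BooleanCube.halfspace a t)
          ≤ c₄ * BooleanCube.mean (BooleanCube.halfspace a t) →
        c₂ * BooleanCube.mean (BooleanCube.halfspace a t) ^ 2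
            * Real.log (1 / BooleanCube.mean (BooleanCube.halfspace a t)) ^ k
          ≤ BooleanCube.weight k (BooleanCube.halfspace a t) ∧
        BooleanCube.weight k (BooleanCube.halfspace a t)
          ≤ c₃ * BooleanCube.mean (BooleanCube.halfspace a t) ^ 2
            * Real.log (1 / BooleanCube.mean (BooleanCube.halfspace a t)) ^ k) := by
  open BooleanCube in
  refine ⟨⟨1, 600, one_pos, by norm_num, ?_⟩, ?_⟩
  · intro k hk n a t i₀ hmax hE hI
    have hk' : (1 : ℝ) ≤ k := by exact_mod_cast hk
    have hE0 : 0 ≤ mean (halfspace a t) := mean_nonneg (halfspace_nonneg a t)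
    rw [one_mul] at hI
    refine le_trans ?_ (weight_ge_of_influence_le hmax hk hE (hI.trans (div_le_self hE0 hk')))
    have hL : 0 ≤ Real.log (1 / mean (halfspace a t)) := by
      rcases hE0.eq_or_lt with h0 | h0
      · simp [← h0]
      refine Real.log_nonneg ((one_le_div h0).2 (hE.le.trans ?_))
      exact zpow_le_one_of_nonpos₀ (by norm_num) (by omega)
    have hlog : 400 ≤ 600 * Real.log (2 * k) := by
      have h1 := Real.log_two_gt_d9
      have h2 : Real.log 2 ≤ Real.log (2 * k) := Real.log_le_log two_pos (by linarith)
      linarith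
    have hpow : (600 * Real.log (2 * k)) ^ (-(k : ℤ)) ≤ ((400 : ℝ) ^ k)⁻¹ := by
      rw [zpow_neg, zpow_natCast]
      gcongr
    calc _ ≤ ((400 : ℝ) ^ k)⁻¹ / (Nat.factorial k : ℝ) * mean (halfspace a t) ^ 2 *
          Real.log (1 / mean (halfspace a t)) ^ k := by gcongr
      _ = _ := by rw [div_pow]; ring
  · intro k hk
    have hk' : (1 : ℝ) ≤ k := by exact_mod_cast hk
    refine ⟨(2 : ℝ) ^ (-(1000 * k : ℤ)), (1 / 400) ^ k / (Nat.factorial k : ℝ),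
      Real.exp 1 * 3 ^ k, 1, by positivity, by positivity, by positivity, one_pos, ?_⟩
    intro n a t hE hI
    rcases (mean_nonneg (halfspace_nonneg a t)).eq_or_lt with h0 | h0
    · have hz := eq_zero_of_mean_eq_zero (halfspace_nonneg a t) h0.symm
      rw [weight_eq_zero hz, ← h0]
      simp
    have hE' : mean (halfspace a t) < (2 : ℝ) ^ (-(999 * k : ℤ)) :=
      hE.trans_lt (zpow_lt_zpow_right₀ (by norm_num) (by omega))
    have hL : 1 ≤ Real.log (1 / mean (halfspace a t)) := by
      have h1 := Real.log_lt_log h0 hE'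
      rw [Real.log_zpow] at h1
      push_cast at h1
      have h2 := Real.log_two_gt_d9
      rw [one_div, Real.log_inv]
      nlinarith
    refine ⟨?_, weight_le (halfspace_eq_zero_or_one a t) h0 hL k⟩
    have hne : Nonempty (Fin n) := by
      by_contra h
      rw [not_nonempty_iff] at h
      -- On the cube with one point a positive mean is `1`.
      have h1 : mean (halfspace a t) = halfspace a t default := by
        rw [← mean_const (n := n) (halfspace a t default)]
        congr 1
        ext x
        rw [Subsingleton.elim x default]
      rcases halfspace_eq_zero_or_one a t default with h2 | h2
      · rw [h1, h2] at h0
        exact lt_irrefl _ h0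
      · rw [h1, h2] at hL
        norm_num at hL
    obtain ⟨i₀, hmax⟩ := Finite.exists_max fun i => |a i|
    have hI₀ : influence (halfspace a t) i₀ ≤ mean (halfspace a t) := by
      rw [one_mul] at hI
      exact (le_ciSup (Set.finite_range (influence (halfspace a t))).bddAbove i₀).trans hI
    refine le_trans (le_of_eq ?_) (weight_ge_of_influence_le hmax hk hE' hI₀)
    rw [div_pow _ (400 : ℝ), div_pow _ (400 : ℝ), one_pow]
    ring
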